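/- Model. There are finitely many validators, of which a strict majority is honest and at least one is corrupt. Time proceeds in slots $1,2,\dots$; in each slot every validator is eligible with probability $p\in(0,1]$, independently over validators and slots. A validator creates at most one block per slot, and only when eligible. A block carries its slot, validator, a payload, a public-coin label $y$ and a non-empty set $\mathrm{refs}(b)$ of blocks created in earlier slots; $a\preceq b$ means that $a=b$ or $a$ is reached from $b$ by following references, and $\mathrm{Anc}^*(b)=\{a:a\preceq b\}$, $\mathrm{Desc}^*(b)=\{d:b\preceq d\}$. Initially there is only the genesis block (slot $0$). The network is synchronous: at the end of each slot all honest parties share the same view $V_t$ (a set of blocks). An eligible honest validator creates in slot $t$ a block that references all tips of $V_{t-1}$ (the blocks of $V_{t-1}$ not referenced within $V_{t-1}$), and this block belongs to $V_t$; its payload is sampled by an arbitrary procedure. The adversary sees the honest blocks of slot $t$, then may let each eligible corrupt validator create one block with arbitrary payload and arbitrary non-empty references to previously created blocks, and releases any set of blocks created so far; released blocks all of whose ancestors are known or released join $V_t$, all other blocks stay withheld. Its decisions depend only on the past and on the current slot. Payload conflict is a symmetric relation such that every finite set of payloads admits a payload conflicting with each of its members. Fork choice with infinite horizon. Two distinct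 conflicting tips $x,y$ of a view $V$ are compared by the unbounded subDAG weight $$W(x;c)=\sum_{d\in V\cap S(x)\cap\mathrm{Desc}^*(c)}|\mathrm{refs}(d)|,$$ which counts all references since genesis, without a window; the larger weight wins, and ties go to the larger label (then to the larger validator index). Here $S(x)$ is either $\mathrm{Desc}^*(x)$ for all tips or $\mathrm{Anc}^*(x)$ for all tips, and the anchor $c$ is either always the closest common ancestor of $x,y$ (the common strict ancestor with largest slot, ties broken by label and then validator index) or always genesis. The preferred frontier $F(V)$ is the set of tips that lose against no conflicting tip, and the ledger is $L(V)=V\cap\bigcup_{x\in F(V)}\mathrm{Anc}^*(x)$. A block $B\in L(V)$ is $k$-deep if every reference path from $B$ to a member of $F(V)$ has length at least $k$. Lemma (unsafe infinite-horizon subDAG weight). For each of these four versions of the weight there are an adversarial strategy and a constant $\varepsilon>0$ such that for every $k\in\mathbb N$ there are slots $t_1<t_2$ for which, with probability at least $\varepsilon$, the following happens: some honest block $B$ is $k$-deep in $V_{t_1}$ but $B\notin L(V_{t_2})$, while $F(V_{t_2})\neq\emptyset$; and some block created in a slot $\le t_1-k$ that was still withheld at the end of slot $t_1$ belongs to $V_{t_2}$.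 -/

import Mathlib

open MeasureTheory ProbabilityTheory
open scoped Classical

noncomputable section

namespace SubDAG

universe u

/-- Blocks over the validator set `Fin n` with payloads in `P`. A block other than genesis carries
its slot, its validator, its payload, its public-coin label and the list of blocks it references. -/
inductive Block (n : ℕ) (P : Type u) : Type u
  | genesis : Block n P
  | mk (slot : ℕ) (validator : Fin n) (payload : P) (label : ℝ) (refs : List (Block n P)) : Block n P

namespace Block

variable {n : ℕ} {P : Type u}

def slot : Block n P → ℕ
  | genesis => 0
  | mk s _ _ _ _ => s

def validator : Block n P → Option (Fin n)
  | genesis => none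
  | mk _ v _ _ _ => some v

def payload : Block n P → Option P
  | genesis => none
  | mk _ _ a _ _ => some a

def label : Block n P → ℝ
  | genesis => 0
  | mk _ _ _ y _ => y

/-- The set of referenced blocks; its cardinality counts each referenced block once. -/
def refs : Block n P → Finset (Block n P)
  | genesis => ∅
  | mk _ _ _ _ r => r.toFinset

/-- Position of the validator in the validator list. -/
def index : Block n P → ℕ
  | genesis => 0
  | mk _ v _ _ _ => (v : ℕ) + 1

/-- Public-coin label; equal labels are separated by the validator index. -/
def coinKey (b : Block n P) : ℝ ×ₗ ℕ := toLex (b.label, b.index)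

/-- Slot first, then the public-coin label. -/
def slotKey (b : Block n P) : ℕ ×ₗ (ℝ ×ₗ ℕ) := toLex (b.slot, b.coinKey)

end Block

variable {n : ℕ} {P : Type u}

/-- The edge `a → b` of the reference DAG: `b` references `a`. -/
def Edge (a b : Block n P) : Prop := a ∈ b.refs

/-- Strict ancestry: a nonempty directed path from `a` to `b`. -/
def Anc (a b : Block n P) : Prop := Relation.TransGen Edge a b

/-- Reflexive ancestry, `a ≼ b`. -/
def AncEq (a b : Block n P) : Prop := Relation.ReflTransGen Edge a b

/-- There is a directed path with exactly `m` edges from `a` to `b`. -/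
def RefPath : ℕ → Block n P → Block n P → Prop
  | 0, a, b => a = b
  | m + 1, a, b => ∃ c, RefPath m a c ∧ Edge c b

/-! ### Fork choice with an infinite horizon -/

/-- Tips of a view: blocks that no block of the view references. -/
def tips (V : Finset (Block n P)) : Finset (Block n P) :=
  V.filter fun b => ∀ d ∈ V, ¬ Edge b d

/-- `c` is the closest common ancestor of `x` and `y` in the view `V`. -/
def IsCCA (V : Finset (Block n P)) (x y c : Block n P) : Prop :=
  (c ∈ V ∧ Anc c x ∧ Anc c y) ∧
    ∀ c' ∈ V, Anc c' x → Anc c' y → c'.slotKey ≤ c.slotKey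

/-- Where the competition between two tips is anchored: at their closest common ancestor, or at
genesis. -/
inductive Anchor
  | cca
  | genesis

def IsAnchor : Anchor → Finset (Block n P) → Block n P → Block n P → Block n P → Prop
  | .cca, V, x, y, c => IsCCA V x y c
  | .genesis, _, _, _, c => c = Block.genesis

/-- Which blocks above the anchor belong to the subDAG of a tip `x`: the members of `Desc*(x)`, or
the blocks between the anchor and `x`, i.e. the members of `Anc*(x)`. -/
inductive Region
  | descendants
  | between

def InRegion : Region → Block n P → Block n P → Prop
  | .descendants, x, d => AncEq x d
  | .between, x, d => AncEq d x

/-- SubDAG weight of `x` above the anchor `c` with an unbounded window: every reference made by a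
block of the subDAG counts, however old it is. -/
def weight (R : Region) (V : Finset (Block n P)) (x c : Block n P) : ℕ :=
  ∑ d ∈ V.filter (fun d => InRegion R x d ∧ AncEq c d), d.refs.card

def ConflictingBlocks (conflicts : P → P → Prop) (x y : Block n P) : Prop :=
  ∃ a b, x.payload = some a ∧ y.payload = some b ∧ conflicts a b

/-- Resolution of two conflicting tips in favour of `x`: larger weight, then larger label. -/
def Beats (R : Region) (K : Anchor) (V : Finset (Block n P)) (x y : Block n P) : Prop :=
  ∃ c, IsAnchor K V x y c ∧
    (weight R V y c < weight R V x c ∨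
      (weight R V y c = weight R V x c ∧ y.coinKey < x.coinKey))

/-- The preferred frontier: tips that are not defeated by a conflicting tip. -/
def preferredFrontier (conflicts : P → P → Prop) (R : Region) (K : Anchor) (V : Finset (Block n P)) :
    Finset (Block n P) :=
  (tips V).filter fun x =>
    ∀ y ∈ tips V, y ≠ x → ConflictingBlocks conflicts y x → ¬ Beats R K V y x

/-- The ledger of a view: the ancestor closure of the preferred frontier. -/
def ledger (conflicts : P → P → Prop) (R : Region) (K : Anchor) (V : Finset (Block n P)) :
    Finset (Block n P) :=
  V.filter fun b => ∃ x ∈ preferredFrontier conflicts R K V, AncEq b x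

/-- `B` is in the ledger, at distance at least `k` beneath the preferred frontier. -/
def IsDeep (conflicts : P → P → Prop) (R : Region) (K : Anchor) (k : ℕ)
    (V : Finset (Block n P)) (B : Block n P) : Prop :=
  B ∈ ledger conflicts R K V ∧
    ∀ x ∈ preferredFrontier conflicts R K V, ∀ m, RefPath m B x → k ≤ m

/-! ### Synchronous execution against an adversary -/

/-- `created`: all blocks created so far. `pub`: the view that all honest parties share. -/
structure State (n : ℕ) (P : Type u) where
  created : Finset (Block n P)
  pub : Finset (Block n P)

/-- One realization of the randomness: eligibility and label of each validator in each slot, and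
the payload that an honest validator samples in a given slot on a given view. -/
structure Coins (n : ℕ) (P : Type u) where
  eligible : ℕ → Fin n → Bool
  label : ℕ → Fin n → ℝ
  payload : ℕ → Fin n → Finset (Block n P) → P

/-- An adversarial strategy. In slot `t`, given the state at the end of the previous slot, the
honest blocks of slot `t` and the validators eligible in slot `t`, `forge` gives for each eligible
corrupt validator the references and the payload of at most one new block. Then `release` names,
given the updated state, the blocks to be shown to the honest parties; all others stay withheld. -/
structure Strategy (n : ℕ) (P : Type u) where
  forge : ℕ → State n P → Finset (Block n P) → Finset (Fin n) → Fin n →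
    Option (List (Block n P) × P)
  forge_valid : ∀ t σ fresh el v r a, forge t σ fresh el v = some (r, a) →
    r ≠ [] ∧ ∀ b ∈ r, b ∈ σ.created
  release : ℕ → State n P → Finset (Block n P)

def eligibleSet (c : Coins n P) (t : ℕ) : Finset (Fin n) :=
  Finset.univ.filter fun v => c.eligible t v = true

/-- Every eligible honest validator creates one block referencing all tips of the honest view. -/
def honestBlocks (honest : Finset (Fin n)) (c : Coins n P) (t : ℕ) (V : Finset (Block n P)) :
    Finset (Block n P) :=
  (eligibleSet c t ∩ honest).image fun v =>
    Block.mk t v (c.payload t v V) (c.label t v) (tips V).toList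

def forgedBlocks (honest : Finset (Fin n)) (A : Strategy n P) (c : Coins n P) (t : ℕ)
    (σ : State n P) (fresh : Finset (Block n P)) : Finset (Block n P) :=
  (eligibleSet c t \ honest).biUnion fun v =>
    match A.forge t σ fresh (eligibleSet c t) v with
    | none => ∅
    | some (r, a) => {Block.mk t v a (c.label t v) r}

/-- Reception: a released block is accepted if all its ancestors are known or released as well. -/
def accept (base released : Finset (Block n P)) : Finset (Block n P) :=
  base ∪ released.filter fun b => ∀ a, AncEq a b → a ∈ base ∪ released

/-- One slot. Honest blocks reach all honest parties by the end of the slot. -/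
def step (honest : Finset (Fin n)) (A : Strategy n P) (c : Coins n P) (t : ℕ) (σ : State n P) :
    State n P :=
  let fresh := honestBlocks honest c t σ.pub
  let σ' : State n P :=
    { created := σ.created ∪ fresh ∪ forgedBlocks honest A c t σ fresh
      pub := σ.pub ∪ fresh }
  { created := σ'.created
    pub := accept σ'.pub (A.release t σ' ∩ σ'.created) }

/-- The state at the end of slot `t`; slot `0` holds genesis only. -/
def exec (honest : Finset (Fin n)) (A : Strategy n P) (c : Coins n P) : ℕ → State n P
  | 0 => { created := {Block.genesis}, pub := {Block.genesis} }
  | t + 1 => step honest A c (t + 1) (exec honest A c t)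

/-- An honest block that is `k`-deep at the end of slot `t₁` is no longer in the honest ledger at
the end of slot `t₂`, and blocks that had been withheld for at least `k` slots at the end of `t₁`
have been revealed in between. -/
def WithholdingReversion (conflicts : P → P → Prop) (R : Region) (K : Anchor)
    (honest : Finset (Fin n)) (A : Strategy n P) (c : Coins n P) (k t₁ t₂ : ℕ) : Prop :=
  (∃ B : Block n P, (∃ v ∈ honest, B.validator = some v) ∧
      IsDeep conflicts R K k (exec honest A c t₁).pub B ∧
      B ∉ ledger conflicts R K (exec honest A c t₂).pub) ∧
    (preferredFrontier conflicts R K (exec honest A c t₂).pub).Nonempty ∧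
    ∃ b ∈ (exec honest A c t₁).created, b.slot + k ≤ t₁ ∧
      b ∉ (exec honest A c t₁).pub ∧ b ∈ (exec honest A c t₂).pub

end SubDAG

end

noncomputable section

namespace SubDAG

variable {n : ℕ} {P : Type*}

/-! ### The reference DAG -/

/-! Without a window, references can be hoarded. One corrupt validator `v` keeps a secret chain:
whenever eligible it forges a block referencing genesis and all blocks it still withholds, so `q`
withheld blocks carry at least `1 + ... + q`, about `q²/2`, references. An honest block references
only the current tips. If at most `C` blocks existed at the last release and `n ≤ C`, each public
block has at most `C` references, so the public weight grows only linearly with the time since that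
release (`EpochBounds`).

When everything is released, a last forged block `x` references genesis and the whole hoard, with a
payload conflicting with all earlier and all simultaneous honest blocks. Secret and public blocks
share no ancestor except genesis, so both anchors are genesis. In the ancestor version `x` wins by
quadratic against linear growth; in the descendant version a tip weighs only its own references, and
`x` has more than `C`. Thus `x` alone is preferred, and its ancestors contain no earlier public
block except genesis (`EpochBounds.preferredFrontier_release`, `EpochBounds.notMem_ledger_release`).

Until then each slot with an eligible honest validator adds a layer above all tips, so an honest
block from early in the epoch becomes deep (`Sinking`).

A single strategy serves every `k`: a release leaves nothing withheld and the attack restarts, with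
epoch `k` long enough for the blocks existing at its start. In each epoch, `v` and an honest `w` are
jointly eligible in enough slots, and `v` at the release, with probability at least `p³/2`. This
needs only expectations (`le_measureReal_card_filter`). -/

theorem sizeOf_lt_of_edge {a b : Block n P} (h : Edge a b) : sizeOf a < sizeOf b := by
  cases b with
  | genesis => simp [Edge, Block.refs] at h
  | mk s v p l r =>
    simp only [Edge, Block.refs, List.mem_toFinset] at h
    have := List.sizeOf_lt_of_mem h
    simp only [Block.mk.sizeOf_spec]
    omega

theorem sizeOf_lt_of_anc {a b : Block n P} (h : Anc a b) : sizeOf a < sizeOf b := by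
  induction h with
  | single h => exact sizeOf_lt_of_edge h
  | tail _ h ih => exact ih.trans (sizeOf_lt_of_edge h)

theorem Anc.ne {a b : Block n P} (h : Anc a b) : a ≠ b := by
  rintro rfl
  exact lt_irrefl _ (sizeOf_lt_of_anc h)

theorem ancEq_iff {a b : Block n P} : AncEq a b ↔ a = b ∨ Anc a b := by
  rw [AncEq, Relation.reflTransGen_iff_eq_or_transGen, eq_comm, Anc]

theorem anc_iff {a b : Block n P} : Anc a b ↔ ∃ d ∈ b.refs, AncEq a d :=
  ⟨fun h => by
    obtain ⟨d, h₁, h₂⟩ := Relation.TransGen.tail'_iff.1 h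
    exact ⟨d, h₂, h₁⟩,
   fun ⟨_, h₁, h₂⟩ => Relation.TransGen.tail'_iff.2 ⟨_, h₂, h₁⟩⟩

theorem tips_nonempty {V : Finset (Block n P)} (hV : V.Nonempty) : (tips V).Nonempty := by
  obtain ⟨b, hb, hmax⟩ := V.exists_max_image (fun b => sizeOf b) hV
  exact ⟨b, Finset.mem_filter.2 ⟨hb, fun d hd h =>
    (hmax d hd).not_gt (sizeOf_lt_of_edge h)⟩⟩

/-- A set of blocks that contains all references of its members. -/
def RefClosed (V : Finset (Block n P)) : Prop := ∀ b ∈ V, b.refs ⊆ V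

theorem RefClosed.ancEq_mem {V : Finset (Block n P)} (hV : RefClosed V) {a b : Block n P}
    (h : AncEq a b) (hb : b ∈ V) : a ∈ V := by
  induction h using Relation.ReflTransGen.head_induction_on with
  | refl => exact hb
  | head h _ ih => exact hV _ ih h

theorem eq_of_mem_tips {V : Finset (Block n P)} (hV : RefClosed V) {x d : Block n P}
    (hx : x ∈ tips V) (hd : d ∈ V) (h : AncEq x d) : d = x := by
  rcases Relation.ReflTransGen.cases_head h with h | ⟨e, he, hed⟩
  · exact h.symm
  · exact absurd he ((Finset.mem_filter.1 hx).2 e (hV.ancEq_mem hed hd))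

/-- A nonempty layer of new blocks referencing all tips replaces the tips. -/
theorem tips_union {V N : Finset (Block n P)} (hV : RefClosed V) (hN : N.Nonempty)
    (hNV : ∀ b ∈ N, b ∉ V) (hr : ∀ b ∈ N, b.refs = tips V) : tips (V ∪ N) = N := by
  ext b
  simp only [tips, Finset.mem_filter, Finset.mem_union]
  constructor
  · rintro ⟨hb | hb, h⟩
    · exfalso
      obtain ⟨f, hf⟩ := hN
      have hbt : b ∈ tips V := Finset.mem_filter.2 ⟨hb, fun d hd => h d (.inl hd)⟩
      exact h f (.inr hf) (by rw [Edge, hr f hf]; exact hbt)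
    · exact hb
  · intro hb
    refine ⟨.inr hb, ?_⟩
    rintro d (hd | hd) he
    · exact hNV b hb (hV d hd he)
    · rw [Edge, hr d hd] at he
      exact hNV b hb (Finset.mem_filter.1 he).1

/-! ### Weights of tips and the preferred frontier. -/

theorem ancEq_iff_of_refs_eq {x y c : Block n P} (h : x.refs = y.refs) (hx : c ≠ x) (hy : c ≠ y) :
    AncEq c x ↔ AncEq c y := by
  rw [ancEq_iff, ancEq_iff, anc_iff, anc_iff, h]
  simp only [hx, hy]

/-- Splitting off the contribution of `x` itself leaves a sum over strict ancestors, which depends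
on `x` only through its references. -/
theorem weight_between_eq {V : Finset (Block n P)} {x c : Block n P} (hx : x ∈ V) :
    weight .between V x c = (if AncEq c x then x.refs.card else 0) +
      ∑ d ∈ V.filter (fun d => Anc d x ∧ AncEq c d), d.refs.card := by
  have hs : V.filter (fun d => InRegion .between x d ∧ AncEq c d) =
      (({x} : Finset _).filter (fun d => AncEq c d)) ∪
        V.filter (fun d => Anc d x ∧ AncEq c d) := by
    ext d
    rw [Finset.mem_filter, Finset.mem_union, Finset.mem_filter, Finset.mem_filter,
      Finset.mem_singleton, InRegion, ancEq_iff (a := d)]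
    constructor
    · rintro ⟨h, rfl | h', h''⟩
      · exact .inl ⟨rfl, h''⟩
      · exact .inr ⟨h, h', h''⟩
    · rintro (⟨rfl, h⟩ | ⟨h, h', h''⟩)
      · exact ⟨hx, .inl rfl, h⟩
      · exact ⟨h, .inr h', h''⟩
  rw [weight, hs, Finset.sum_union, Finset.sum_filter, Finset.sum_singleton]
  rw [Finset.disjoint_left]
  intro d hd hd'
  simp only [Finset.mem_filter, Finset.mem_singleton] at hd hd'
  exact hd'.2.1.ne hd.1

/-- A tip of a closed view has no descendant but itself, so this version of the weight degenerates
to a single reference count. -/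
theorem weight_descendants_eq {V : Finset (Block n P)} (hV : RefClosed V) {x c : Block n P}
    (hx : x ∈ tips V) :
    weight .descendants V x c = if AncEq c x then x.refs.card else 0 := by
  have hs : V.filter (fun d => InRegion .descendants x d ∧ AncEq c d) =
      ({x} : Finset _).filter (fun d => AncEq c d) := by
    ext d
    rw [Finset.mem_filter, Finset.mem_filter, Finset.mem_singleton, InRegion]
    constructor
    · rintro ⟨h, h', h''⟩
      exact ⟨eq_of_mem_tips hV hx h h', h''⟩
    · rintro ⟨rfl, h⟩
      exact ⟨(Finset.mem_filter.1 hx).1, .refl, h⟩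
  rw [weight, hs, Finset.sum_filter, Finset.sum_singleton]

theorem weight_eq_of_refs_eq {V : Finset (Block n P)} (hV : RefClosed V) (R : Region)
    {x y c : Block n P} (hx : x ∈ tips V) (hy : y ∈ tips V) (h : x.refs = y.refs)
    (hcx : c ≠ x) (hcy : c ≠ y) : weight R V x c = weight R V y c := by
  cases R with
  | descendants =>
    rw [weight_descendants_eq hV hx, weight_descendants_eq hV hy, h,
      ancEq_iff_of_refs_eq h hcx hcy]
  | between =>
    rw [weight_between_eq (Finset.mem_filter.1 hx).1, weight_between_eq (Finset.mem_filter.1 hy).1,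
      h, ancEq_iff_of_refs_eq h hcx hcy]
    simp only [anc_iff, h]

/-- Tips with the same references tie in weight, so the largest coin is preferred. -/
theorem preferredFrontier_nonempty_of_refs_eq {conflicts : P → P → Prop} {R : Region} {K : Anchor}
    {V : Finset (Block n P)} (hV : RefClosed V) (hne : V.Nonempty)
    (hrefs : ∀ x ∈ tips V, ∀ y ∈ tips V, x.refs = y.refs)
    (hgen : Block.genesis ∉ tips V) : (preferredFrontier conflicts R K V).Nonempty := by
  obtain ⟨x, hx, hmax⟩ := (tips V).exists_max_image Block.coinKey (tips_nonempty hne)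
  refine ⟨x, Finset.mem_filter.2 ⟨hx, ?_⟩⟩
  rintro y hy - - ⟨c, hc, hw⟩
  -- An anchor equal to one of the tips would break the symmetry between them.
  have hc' : c ≠ x ∧ c ≠ y := by
    cases K with
    | cca => exact ⟨hc.1.2.2.ne, hc.1.2.1.ne⟩
    | genesis =>
      simp only [IsAnchor] at hc
      subst hc
      exact ⟨fun h => hgen (h ▸ hx), fun h => hgen (h ▸ hy)⟩
  rw [weight_eq_of_refs_eq hV R hx hy (hrefs x hx y hy) hc'.1 hc'.2] at hw
  rcases hw with hw | hw
  · exact lt_irrefl _ hw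
  · exact (hmax y hy).not_gt hw.2

theorem exists_isAnchor {V : Finset (Block n P)} (K : Anchor) {x y : Block n P}
    (hg : Block.genesis ∈ V) (hx : Anc Block.genesis x) (hy : Anc Block.genesis y) :
    ∃ c, IsAnchor K V x y c := by
  cases K with
  | genesis => exact ⟨_, rfl⟩
  | cca =>
    obtain ⟨c, hc, hmax⟩ := (V.filter fun c => Anc c x ∧ Anc c y).exists_max_image Block.slotKey
      ⟨_, Finset.mem_filter.2 ⟨hg, hx, hy⟩⟩
    have hc := Finset.mem_filter.1 hc
    exact ⟨c, hc, fun c' h h₁ h₂ => hmax c' (Finset.mem_filter.2 ⟨h, h₁, h₂⟩)⟩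

/-- Two blocks whose only common strict ancestor is genesis are compared above genesis. -/
theorem IsAnchor.eq_genesis {K : Anchor} {V : Finset (Block n P)} {x y c : Block n P}
    (h : IsAnchor K V x y c) (hxy : ∀ c, Anc c x → Anc c y → c = Block.genesis) :
    c = Block.genesis := by
  cases K with
  | cca => exact hxy c h.1.2.1 h.1.2.2
  | genesis => exact h

/-- A tip that conflicts with all others and outweighs them is the whole preferred frontier. -/
theorem preferredFrontier_eq_singleton {conflicts : P → P → Prop} {R : Region} {K : Anchor}
    {V : Finset (Block n P)} {x : Block n P} (hx : x ∈ tips V)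
    (hconf : ∀ y ∈ tips V, y ≠ x → ConflictingBlocks conflicts x y)
    (hanc : ∀ y ∈ tips V, y ≠ x → ∃ c, IsAnchor K V x y c)
    (hxy : ∀ y ∈ tips V, y ≠ x → ∀ c, Anc c x → Anc c y → c = Block.genesis)
    (hw : ∀ y ∈ tips V, y ≠ x → weight R V y .genesis < weight R V x .genesis) :
    preferredFrontier conflicts R K V = {x} := by
  ext y
  simp only [preferredFrontier, Finset.mem_filter, Finset.mem_singleton]
  constructor
  · rintro ⟨hy, h⟩
    by_contra hne
    obtain ⟨c, hc⟩ := hanc y hy hne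
    have hcg := hc.eq_genesis (hxy y hy hne)
    exact h x hx (Ne.symm hne) (hconf y hy hne) ⟨c, hc, .inl (hcg ▸ hw y hy hne)⟩
  · rintro rfl
    refine ⟨hx, ?_⟩
    rintro z hz hne - ⟨c, hc, h⟩
    have hcg := hc.eq_genesis fun c h₁ h₂ => hxy z hz hne c h₂ h₁
    subst hcg
    have := hw z hz hne
    omega

/-! ### The withholding strategy -/

/-- Genesis and all withheld blocks. -/
def withheldRefs (σ : State n P) : Finset (Block n P) :=
  insert Block.genesis (σ.created \ σ.pub)

/-- The corrupt validator `v` extends the withheld blocks in each slot, referencing all of them,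
with a payload chosen against all existing blocks. All blocks are released in the slots of `T`. -/
def withholdingStrategy (rival : Finset (Block n P) → P) (v : Fin n) (T : Set ℕ) :
    Strategy n P where
  forge _ σ fresh _ u :=
    -- `forge_valid` quantifies over arbitrary states, hence the check for genesis. Genesis keeps
    -- the reference list nonempty even when nothing is withheld.
    if u = v ∧ Block.genesis ∈ σ.created then
      some ((withheldRefs σ).toList, rival (σ.created ∪ fresh))
    else none
  forge_valid := by
    intro t σ fresh el u r a h
    split_ifs at h with hu
    simp only [Option.some.injEq, Prod.mk.injEq] at h
    obtain ⟨rfl, -⟩ := h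
    refine ⟨?_, ?_⟩
    · simp [withheldRefs]
    · intro b hb
      simp only [withheldRefs, Finset.mem_toList, Finset.mem_insert, Finset.mem_sdiff] at hb
      rcases hb with rfl | hb
      · exact hu.2
      · exact hb.1
  release t σ := if t ∈ T then σ.created else ∅

/-- The block that the corrupt validator forges in slot `t` on top of the state `σ`. -/
def forgedBlock (honest : Finset (Fin n)) (rival : Finset (Block n P) → P) (v : Fin n)
    (c : Coins n P) (t : ℕ) (σ : State n P) : Block n P :=
  Block.mk t v (rival (σ.created ∪ honestBlocks honest c t σ.pub)) (c.label t v)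
    (withheldRefs σ).toList

/-- Invariants of every execution against the withholding strategy at the end of slot `t`. -/
structure Coherent (σ : State n P) (t : ℕ) : Prop where
  pub_subset : σ.pub ⊆ σ.created
  genesis_mem : Block.genesis ∈ σ.pub
  slot_le : ∀ b ∈ σ.created, b.slot ≤ t
  created_closed : RefClosed σ.created
  pub_closed : RefClosed σ.pub
  genesis_ancEq : ∀ b ∈ σ.created, AncEq Block.genesis b
  card_le : σ.created.card ≤ 1 + (n + 1) * t

/-! ### Single slots and invariants of the execution. -/

theorem mem_honestBlocks {honest : Finset (Fin n)} {c : Coins n P} {t : ℕ}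
    {V : Finset (Block n P)} {b : Block n P} (h : b ∈ honestBlocks honest c t V) :
    b.slot = t ∧ b.refs = tips V ∧ (∃ u ∈ honest, b.validator = some u) ∧ b ≠ Block.genesis := by
  simp only [honestBlocks, Finset.mem_image, Finset.mem_inter] at h
  obtain ⟨u, ⟨-, hu⟩, rfl⟩ := h
  exact ⟨rfl, by simp [Block.refs], ⟨u, hu, rfl⟩, by simp⟩

theorem card_honestBlocks_le (honest : Finset (Fin n)) (c : Coins n P) (t : ℕ)
    (V : Finset (Block n P)) : (honestBlocks honest c t V).card ≤ n :=
  Finset.card_image_le.trans ((Finset.card_le_univ _).trans (by simp))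

section Execution

variable {honest : Finset (Fin n)} {rival : Finset (Block n P) → P} {v : Fin n} {T : Set ℕ}
  {c : Coins n P}

theorem forgedBlocks_withholdingStrategy (hv : v ∉ honest) (t : ℕ) {σ : State n P}
    (hg : Block.genesis ∈ σ.created) :
    forgedBlocks honest (withholdingStrategy rival v T) c t σ (honestBlocks honest c t σ.pub) =
      if c.eligible t v = true then {forgedBlock honest rival v c t σ} else ∅ := by
  ext b
  simp only [forgedBlocks, Finset.mem_biUnion, Finset.mem_sdiff, eligibleSet, Finset.mem_filter,
    Finset.mem_univ, true_and, withholdingStrategy, hg, and_true]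
  constructor
  · rintro ⟨u, ⟨hu, -⟩, hb⟩
    by_cases huv : u = v
    · subst huv
      simp only [if_true, Finset.mem_singleton] at hb
      simp [hu, hb, forgedBlock]
    · simp [huv] at hb
  · intro hb
    split_ifs at hb with he
    · refine ⟨v, ⟨he, hv⟩, ?_⟩
      simpa [forgedBlock] using hb
    · simp at hb

theorem refs_forgedBlock (t : ℕ) (σ : State n P) :
    (forgedBlock honest rival v c t σ).refs = withheldRefs σ := by
  simp [forgedBlock, Block.refs]

theorem created_step (hv : v ∉ honest) (t : ℕ) {σ : State n P} (hg : Block.genesis ∈ σ.created) :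
    (step honest (withholdingStrategy rival v T) c t σ).created =
      σ.created ∪ honestBlocks honest c t σ.pub ∪
        if c.eligible t v = true then {forgedBlock honest rival v c t σ} else ∅ := by
  rw [step, ← forgedBlocks_withholdingStrategy (T := T) hv t hg]

theorem pub_step_of_notMem {t : ℕ} (ht : t ∉ T) (σ : State n P) :
    (step honest (withholdingStrategy rival v T) c t σ).pub =
      σ.pub ∪ honestBlocks honest c t σ.pub := by
  simp [step, accept, withholdingStrategy, ht]

theorem withheldRefs_subset {σ : State n P} (hg : Block.genesis ∈ σ.created) :
    withheldRefs σ ⊆ σ.created := by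
  intro b hb
  simp only [withheldRefs, Finset.mem_insert, Finset.mem_sdiff] at hb
  rcases hb with rfl | hb
  exacts [hg, hb.1]

theorem Coherent.mem_created_step (hv : v ∉ honest) {t : ℕ} {σ : State n P} (h : Coherent σ t)
    {b : Block n P}
    (hb : b ∈ (step honest (withholdingStrategy rival v T) c (t + 1) σ).created) :
    b ∈ σ.created ∨ (b.slot = t + 1 ∧ b.refs.Nonempty ∧ b.refs ⊆ σ.created) := by
  rw [created_step hv (t + 1) (h.pub_subset h.genesis_mem)] at hb
  rcases Finset.mem_union.1 hb with hb | hb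
  · rcases Finset.mem_union.1 hb with hb | hb
    · exact .inl hb
    · obtain ⟨h₁, h₂, -⟩ := mem_honestBlocks hb
      exact .inr ⟨h₁, h₂ ▸ tips_nonempty ⟨_, h.genesis_mem⟩,
        h₂ ▸ (Finset.filter_subset _ _).trans h.pub_subset⟩
  · split_ifs at hb with he
    · rw [Finset.mem_singleton] at hb
      subst hb
      rw [refs_forgedBlock]
      exact .inr ⟨rfl, ⟨_, Finset.mem_insert_self _ _⟩,
        withheldRefs_subset (h.pub_subset h.genesis_mem)⟩
    · simp at hb

theorem Coherent.subset_created_step (hv : v ∉ honest) {t : ℕ} {σ : State n P}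
    (h : Coherent σ t) :
    σ.created ⊆ (step honest (withholdingStrategy rival v T) c (t + 1) σ).created := by
  rw [created_step hv (t + 1) (h.pub_subset h.genesis_mem), Finset.union_assoc]
  exact Finset.subset_union_left

theorem Coherent.created_step_closed (hv : v ∉ honest) {t : ℕ} {σ : State n P}
    (h : Coherent σ t) :
    RefClosed (step honest (withholdingStrategy rival v T) c (t + 1) σ).created := by
  intro b hb
  refine Finset.Subset.trans ?_ (h.subset_created_step hv)
  rcases h.mem_created_step hv hb with hb | ⟨-, -, hb⟩
  exacts [h.created_closed b hb, hb]

/-- The created blocks are closed under references, so reception rejects nothing. Afterwards no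
block is withheld and a new secret chain starts at genesis. -/
theorem Coherent.pub_step_of_mem (hv : v ∉ honest) {t : ℕ} {σ : State n P} (h : Coherent σ t)
    (ht : t + 1 ∈ T) :
    (step honest (withholdingStrategy rival v T) c (t + 1) σ).pub =
      (step honest (withholdingStrategy rival v T) c (t + 1) σ).created := by
  have hcl := h.created_step_closed (rival := rival) (T := T) (c := c) hv
  have hsub : σ.pub ∪ honestBlocks honest c (t + 1) σ.pub ⊆
      (step honest (withholdingStrategy rival v T) c (t + 1) σ).created := by
    rw [created_step hv (t + 1) (h.pub_subset h.genesis_mem)]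
    exact (Finset.union_subset_union_left h.pub_subset).trans Finset.subset_union_left
  have hpub : (step honest (withholdingStrategy rival v T) c (t + 1) σ).pub =
      accept (σ.pub ∪ honestBlocks honest c (t + 1) σ.pub)
        (step honest (withholdingStrategy rival v T) c (t + 1) σ).created := by
    conv_lhs => rw [step]
    simp only [withholdingStrategy, if_pos ht, Finset.inter_self]
    rfl
  rw [hpub, accept]
  apply Finset.Subset.antisymm
  · exact Finset.union_subset hsub (Finset.filter_subset _ _)
  · intro b hb
    exact Finset.mem_union_right _ (Finset.mem_filter.2
      ⟨hb, fun a ha => Finset.mem_union_right _ (hcl.ancEq_mem ha hb)⟩)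

theorem Coherent.succ (hv : v ∉ honest) {t : ℕ} {σ : State n P} (h : Coherent σ t) :
    Coherent (step honest (withholdingStrategy rival v T) c (t + 1) σ) (t + 1) := by
  have hcl := h.created_step_closed (rival := rival) (T := T) (c := c) hv
  have hsub := h.subset_created_step (rival := rival) (T := T) (c := c) hv
  have hcr := created_step (rival := rival) (T := T) (c := c) hv (t + 1)
    (h.pub_subset h.genesis_mem)
  refine ⟨?_, ?_, ?_, hcl, ?_, ?_, ?_⟩
  · by_cases ht : t + 1 ∈ T
    · rw [h.pub_step_of_mem hv ht]
    · rw [pub_step_of_notMem ht, hcr]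
      exact (Finset.union_subset_union_left h.pub_subset).trans Finset.subset_union_left
  · by_cases ht : t + 1 ∈ T
    · rw [h.pub_step_of_mem hv ht]
      exact hsub (h.pub_subset h.genesis_mem)
    · rw [pub_step_of_notMem ht]
      exact Finset.mem_union_left _ h.genesis_mem
  · intro b hb
    rcases h.mem_created_step hv hb with hb | ⟨hb, -⟩
    · exact (h.slot_le b hb).trans (Nat.le_succ t)
    · exact hb.le
  · by_cases ht : t + 1 ∈ T
    · rwa [h.pub_step_of_mem hv ht]
    · rw [pub_step_of_notMem ht]
      intro b hb
      refine Finset.Subset.trans ?_ Finset.subset_union_left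
      rcases Finset.mem_union.1 hb with hb | hb
      · exact h.pub_closed b hb
      · rw [(mem_honestBlocks hb).2.1]
        exact Finset.filter_subset _ _
  · intro b hb
    rcases h.mem_created_step hv hb with hb | ⟨-, ⟨d, hd⟩, hb⟩
    · exact h.genesis_ancEq b hb
    · exact (h.genesis_ancEq d (hb hd)).tail hd
  · rw [hcr]
    refine (Finset.card_union_le _ _).trans ?_
    have h₁ := Finset.card_union_le σ.created (honestBlocks honest c (t + 1) σ.pub)
    have h₂ := card_honestBlocks_le honest c (t + 1) σ.pub
    have h₃ := h.card_le
    have h₄ : (if c.eligible (t + 1) v = true then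
        ({forgedBlock honest rival v c (t + 1) σ} : Finset (Block n P)) else ∅).card ≤ 1 := by
      split_ifs <;> simp
    rw [Nat.mul_succ]
    omega

theorem coherent_exec (hv : v ∉ honest) (t : ℕ) :
    Coherent (exec honest (withholdingStrategy rival v T) c t) t := by
  induction t with
  | zero =>
    refine ⟨?_, ?_, ?_, ?_, ?_, ?_, ?_⟩ <;> simp [exec, RefClosed, Block.slot, Block.refs, AncEq,
      Relation.ReflTransGen.refl]
  | succ t ih => exact ih.succ hv

end Execution

section Epoch

variable {honest : Finset (Fin n)} {rival : Finset (Block n P) → P} {v : Fin n} {T : Set ℕ}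
  {c : Coins n P}

/-! ### Growth between two releases -/

theorem Coherent.notMem_of_mem_honestBlocks {t : ℕ} {σ : State n P} (h : Coherent σ t)
    {b : Block n P} (hb : b ∈ honestBlocks honest c (t + 1) σ.pub) : b ∉ σ.created := fun hb' => by
  have h₁ := h.slot_le b hb'
  have h₂ := (mem_honestBlocks hb).1
  omega

theorem Coherent.forgedBlock_notMem {t : ℕ} {σ : State n P} (h : Coherent σ t) :
    forgedBlock honest rival v c (t + 1) σ ∉ σ.created := fun hb => by
  have : t + 1 ≤ t := h.slot_le _ hb
  omega

theorem forgedBlock_notMem_honestBlocks (hv : v ∉ honest) (t : ℕ) (σ : State n P) :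
    forgedBlock honest rival v c t σ ∉ honestBlocks honest c t σ.pub := fun hb => by
  obtain ⟨-, -, ⟨u, hu, hb⟩, -⟩ := mem_honestBlocks hb
  have : v = u := by simpa [forgedBlock, Block.validator] using hb
  exact hv (this ▸ hu)

theorem Coherent.tips_step {t : ℕ} {σ : State n P} (h : Coherent σ t)
    (hne : (honestBlocks honest c (t + 1) σ.pub).Nonempty) :
    tips (σ.pub ∪ honestBlocks honest c (t + 1) σ.pub) = honestBlocks honest c (t + 1) σ.pub :=
  tips_union h.pub_closed hne
    (fun _ hb hb' => h.notMem_of_mem_honestBlocks hb (h.pub_subset hb'))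
    fun _ hb => (mem_honestBlocks hb).2.1

theorem Coherent.withheld_step (hv : v ∉ honest) {t : ℕ} {σ : State n P} (h : Coherent σ t)
    (ht : t + 1 ∉ T) :
    (step honest (withholdingStrategy rival v T) c (t + 1) σ).created \
        (step honest (withholdingStrategy rival v T) c (t + 1) σ).pub =
      (σ.created \ σ.pub) ∪
        if c.eligible (t + 1) v = true then {forgedBlock honest rival v c (t + 1) σ} else ∅ := by
  rw [created_step hv (t + 1) (h.pub_subset h.genesis_mem), pub_step_of_notMem ht]
  ext b
  have h₁ : b ∈ honestBlocks honest c (t + 1) σ.pub → b ∉ σ.created :=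
    h.notMem_of_mem_honestBlocks
  have h₂ : forgedBlock honest rival v c (t + 1) σ ∉ σ.created := h.forgedBlock_notMem
  have h₃ : forgedBlock honest rival v c (t + 1) σ ∉ honestBlocks honest c (t + 1) σ.pub :=
    forgedBlock_notMem_honestBlocks hv _ _
  have h₄ := @h.pub_subset
  split_ifs with he
  · simp only [Finset.mem_sdiff, Finset.mem_union, Finset.mem_singleton]
    constructor
    · tauto
    · rintro (⟨h, h'⟩ | rfl)
      · tauto
      · exact ⟨.inr rfl, fun h => h.elim (fun h => h₂ (h₄ h)) h₃⟩
  · simp only [Finset.mem_sdiff, Finset.mem_union, Finset.notMem_empty]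
    tauto

/-- After a full release: public blocks have at most `C` references, at most `N` blocks were
published, and at least `m` blocks were withheld, each referencing all withheld ones before it. -/
structure EpochBounds (σ : State n P) (C N m : ℕ) : Prop where
  card_pub : σ.pub.card ≤ C + N
  refs_le : ∀ d ∈ σ.pub, d.refs.card ≤ C
  tips_le : (tips σ.pub).card ≤ C
  withheld_refs : ∀ q ∈ σ.created \ σ.pub, q.refs ⊆ withheldRefs σ
  le_card_withheld : m ≤ (σ.created \ σ.pub).card
  sq_card_le : (σ.created \ σ.pub).card ^ 2 ≤ 2 * ∑ q ∈ σ.created \ σ.pub, q.refs.card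

theorem Coherent.epochBounds {t C : ℕ} {σ : State n P} (h : Coherent σ t)
    (hpub : σ.pub = σ.created) (hC : 1 + (n + 1) * t ≤ C) : EpochBounds σ C 0 0 := by
  have hcard : σ.pub.card ≤ C := (Finset.card_le_card h.pub_subset).trans (h.card_le.trans hC)
  exact ⟨hcard, fun d hd => (Finset.card_le_card (h.pub_closed d hd)).trans hcard,
    (Finset.card_le_card (Finset.filter_subset _ _)).trans hcard, by simp [hpub], by simp,
    by simp [hpub]⟩

/-- A nonempty honest layer inherits the old bound on tips as its reference count and then becomes
the set of tips, of size at most `n ≤ C`. A block forged on `q` withheld ones has `q + 1`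
references, and `(q + 1)² ≤ q² + 2(q + 1)`. -/
theorem EpochBounds.succ (hv : v ∉ honest) {t C N m : ℕ} {σ : State n P}
    (hb : EpochBounds σ C N m) (h : Coherent σ t) (ht : t + 1 ∉ T) (hC : n ≤ C) :
    EpochBounds (step honest (withholdingStrategy rival v T) c (t + 1) σ) C (N + n)
      (m + if c.eligible (t + 1) v = true then 1 else 0) := by
  have hw := h.withheld_step (rival := rival) (c := c) hv ht
  have hp := pub_step_of_notMem (honest := honest) (rival := rival) (v := v) (c := c) ht σ
  have hcard := card_honestBlocks_le honest c (t + 1) σ.pub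
  have hfq : forgedBlock honest rival v c (t + 1) σ ∉ σ.created \ σ.pub := fun hq =>
    h.forgedBlock_notMem (Finset.mem_sdiff.1 hq).1
  have hgq : Block.genesis ∉ σ.created \ σ.pub := fun hq =>
    (Finset.mem_sdiff.1 hq).2 h.genesis_mem
  refine ⟨?_, ?_, ?_, ?_, ?_, ?_⟩
  · rw [hp]
    have h₁ := Finset.card_union_le σ.pub (honestBlocks honest c (t + 1) σ.pub)
    have h₂ := hb.card_pub
    omega
  · rw [hp]
    intro d hd
    rcases Finset.mem_union.1 hd with hd | hd
    · exact hb.refs_le d hd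
    · rw [(mem_honestBlocks hd).2.1]
      exact hb.tips_le
  · rw [hp]
    rcases (honestBlocks honest c (t + 1) σ.pub).eq_empty_or_nonempty with he | hne
    · rw [he, Finset.union_empty]
      exact hb.tips_le
    · rw [h.tips_step hne]
      exact hcard.trans hC
  · have hsub : withheldRefs σ ⊆
        withheldRefs (step honest (withholdingStrategy rival v T) c (t + 1) σ) := by
      rw [withheldRefs, withheldRefs, hw]
      exact Finset.insert_subset_insert _ Finset.subset_union_left
    intro q hq
    refine Finset.Subset.trans ?_ hsub
    rw [hw] at hq
    rcases Finset.mem_union.1 hq with hq | hq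
    · exact hb.withheld_refs q hq
    · split_ifs at hq with he
      · rw [Finset.mem_singleton.1 hq, refs_forgedBlock]
      · simp at hq
  · rw [hw]
    split_ifs with he
    · rw [Finset.card_union_of_disjoint (by simpa using hfq), Finset.card_singleton]
      exact Nat.add_le_add_right hb.le_card_withheld 1
    · simpa using hb.le_card_withheld
  · rw [hw]
    split_ifs with he
    · have hd : Disjoint (σ.created \ σ.pub) {forgedBlock honest rival v c (t + 1) σ} := by
        simpa using hfq
      rw [Finset.card_union_of_disjoint hd, Finset.sum_union hd, Finset.card_singleton,
        Finset.sum_singleton, refs_forgedBlock, withheldRefs, Finset.card_insert_of_notMem hgq]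
      nlinarith [hb.sq_card_le]
    · simpa using hb.sq_card_le

theorem EpochBounds.mono {σ : State n P} {C N m N' m' : ℕ} (h : EpochBounds σ C N m)
    (hN : N ≤ N') (hm : m' ≤ m) : EpochBounds σ C N' m' :=
  { h with
    card_pub := h.card_pub.trans (by omega)
    le_card_withheld := hm.trans h.le_card_withheld }

theorem card_filter_le_succ (G : Finset ℕ) (t : ℕ) :
    (G.filter (· ≤ t + 1)).card ≤ (G.filter (· ≤ t)).card + if t + 1 ∈ G then 1 else 0 := by
  have hs : G.filter (· ≤ t + 1) ⊆ G.filter (· ≤ t) ∪ if t + 1 ∈ G then {t + 1} else ∅ := by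
    intro s hs
    obtain ⟨hs, hst⟩ := Finset.mem_filter.1 hs
    rcases Nat.le_succ_iff.1 hst with hst | rfl
    · exact Finset.mem_union_left _ (Finset.mem_filter.2 ⟨hs, hst⟩)
    · simp [hs]
  refine (Finset.card_le_card hs).trans ((Finset.card_union_le _ _).trans ?_)
  split_ifs <;> simp

/-- In `C`, the part `1 + (n + 1) * a` bounds all blocks created up to slot `a`, with at most `n`
honest and one forged per slot. The summand `n` makes room for an honest layer of tips. -/
theorem epochBounds_exec (hv : v ∉ honest) {a t C : ℕ} {G : Finset ℕ} (hat : a ≤ t)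
    (hpub : (exec honest (withholdingStrategy rival v T) c a).pub =
      (exec honest (withholdingStrategy rival v T) c a).created)
    (hT : ∀ s, a < s → s ≤ t → s ∉ T) (hC : 1 + (n + 1) * a + n ≤ C)
    (hG : ∀ s ∈ G, a < s ∧ c.eligible s v = true) :
    EpochBounds (exec honest (withholdingStrategy rival v T) c t) C (n * (t - a))
      (G.filter (· ≤ t)).card := by
  induction t, hat using Nat.le_induction with
  | base =>
    refine ((coherent_exec hv a).epochBounds hpub (by omega)).mono (Nat.zero_le _) ?_
    rw [Nat.le_zero, Finset.card_eq_zero, Finset.filter_eq_empty_iff]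
    intro s hs
    exact (hG s hs).1.not_ge
  | succ t hat ih =>
    have hstep := (ih fun s h₁ h₂ => hT s h₁ (h₂.trans (Nat.le_succ t))).succ
      (rival := rival) (T := T) (c := c) hv (coherent_exec hv t)
      (hT (t + 1) (Nat.lt_succ_of_le hat) le_rfl) (by omega)
    refine hstep.mono ?_ ?_
    · rw [Nat.succ_sub hat, Nat.mul_succ]
    · refine (card_filter_le_succ G t).trans (Nat.add_le_add_left ?_ _)
      by_cases hs : t + 1 ∈ G
      · simp [hs, (hG _ hs).2]
      · simp [hs]

/-! ### An honest block sinks below the tips -/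

/-- The tips of `V` have common references and lie at distance at least `m` above `B`. -/
structure Sinking (B : Block n P) (V : Finset (Block n P)) (m : ℕ) : Prop where
  mem : B ∈ V
  refs_eq : ∀ x ∈ tips V, ∀ y ∈ tips V, x.refs = y.refs
  genesis_notMem : Block.genesis ∉ tips V
  le_length : ∀ x ∈ tips V, ∀ l, RefPath l B x → m ≤ l
  -- In its own slot `B` may have siblings among the tips that do not descend from it; one further
  -- layer removes this exception.
  ancEq : (m = 0 ∧ B ∈ tips V) ∨ ∀ x ∈ tips V, AncEq B x

theorem Coherent.sinking {t : ℕ} {σ : State n P} (h : Coherent σ t) {B : Block n P}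
    (hB : B ∈ honestBlocks honest c (t + 1) σ.pub) :
    Sinking B (σ.pub ∪ honestBlocks honest c (t + 1) σ.pub) 0 := by
  have ht := h.tips_step (honest := honest) (c := c) ⟨B, hB⟩
  refine ⟨Finset.mem_union_right _ hB, ?_, ?_, fun _ _ _ _ => Nat.zero_le _, .inl ⟨rfl, by rwa [ht]⟩⟩
  · rw [ht]
    intro x hx y hy
    rw [(mem_honestBlocks hx).2.1, (mem_honestBlocks hy).2.1]
  · rw [ht]
    exact fun hg => (mem_honestBlocks hg).2.2.2 rfl

theorem Sinking.succ {t m : ℕ} {σ : State n P} {B : Block n P} (hs : Sinking B σ.pub m)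
    (h : Coherent σ t) :
    Sinking B (σ.pub ∪ honestBlocks honest c (t + 1) σ.pub)
      (m + if (honestBlocks honest c (t + 1) σ.pub).Nonempty then 1 else 0) := by
  split_ifs with hne
  · have ht := h.tips_step hne
    have hanc : ∀ x ∈ honestBlocks honest c (t + 1) σ.pub, AncEq B x := by
      intro x hx
      have hxr := (mem_honestBlocks hx).2.1
      rcases hs.ancEq with ⟨-, hB⟩ | hall
      · exact Relation.ReflTransGen.single (show B ∈ x.refs from hxr ▸ hB)
      · obtain ⟨d, hd⟩ := tips_nonempty ⟨_, h.genesis_mem⟩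
        exact (hall d hd).tail (show d ∈ x.refs from hxr ▸ hd)
    refine ⟨Finset.mem_union_left _ hs.mem, ?_, ?_, ?_, .inr (by rwa [ht])⟩
    · rw [ht]
      intro x hx y hy
      rw [(mem_honestBlocks hx).2.1, (mem_honestBlocks hy).2.1]
    · rw [ht]
      exact fun hg => (mem_honestBlocks hg).2.2.2 rfl
    · rw [ht]
      rintro x hx (_ | l) hl
      · have hBx : B = x := hl
        exact absurd (h.pub_subset hs.mem) (hBx ▸ h.notMem_of_mem_honestBlocks hx)
      · obtain ⟨d, hd, hdx⟩ := hl
        rw [Edge, (mem_honestBlocks hx).2.1] at hdx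
        exact Nat.succ_le_succ (hs.le_length d hdx l hd)
  · rw [Finset.not_nonempty_iff_eq_empty.1 hne, Finset.union_empty]
    exact hs

theorem Sinking.mono {B : Block n P} {V : Finset (Block n P)} {m m' : ℕ} (h : Sinking B V m)
    (hm : m' ≤ m) : Sinking B V m' :=
  { h with
    le_length := fun x hx l hl => hm.trans (h.le_length x hx l hl)
    ancEq := h.ancEq.imp_left fun ⟨h₁, h₂⟩ => ⟨by omega, h₂⟩ }

theorem sinking_exec (hv : v ∉ honest) {w : Fin n} (hw : w ∈ honest) {s t : ℕ} {G : Finset ℕ}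
    (hst : s + 1 ≤ t) {B : Block n P}
    (hB : B ∈ honestBlocks honest c (s + 1) (exec honest (withholdingStrategy rival v T) c s).pub)
    (hT : ∀ r, s + 1 ≤ r → r ≤ t → r ∉ T)
    (hG : ∀ r ∈ G, s + 1 < r ∧ c.eligible r w = true) :
    Sinking B (exec honest (withholdingStrategy rival v T) c t).pub
      (G.filter (· ≤ t)).card := by
  induction t, hst using Nat.le_induction with
  | base =>
    rw [exec, pub_step_of_notMem (hT (s + 1) le_rfl le_rfl)]
    refine ((coherent_exec hv s).sinking hB).mono ?_
    rw [Nat.le_zero, Finset.card_eq_zero, Finset.filter_eq_empty_iff]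
    intro r hr
    exact (hG r hr).1.not_ge
  | succ t hst ih =>
    rw [exec, pub_step_of_notMem (hT (t + 1) (hst.trans (Nat.le_succ t)) le_rfl)]
    refine ((ih fun r h₁ h₂ => hT r h₁ (h₂.trans (Nat.le_succ t))).succ
      (coherent_exec hv t)).mono ?_
    refine (card_filter_le_succ G t).trans (Nat.add_le_add_left ?_ _)
    by_cases hr : t + 1 ∈ G
    · have hne : (honestBlocks honest c (t + 1)
          (exec honest (withholdingStrategy rival v T) c t).pub).Nonempty := by
        refine Finset.Nonempty.image ⟨w, ?_⟩ _
        simp [eligibleSet, hw, (hG _ hr).2]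
      simp [hr, hne]
    · simp [hr]

/-- Positive depth puts every tip above `B`, so any preferred tip brings `B` into the ledger; the
weight tie among the tips guarantees that one exists. -/
theorem Sinking.isDeep {B : Block n P} {V : Finset (Block n P)} {m k : ℕ} (h : Sinking B V m)
    (hV : RefClosed V) (hk : k ≤ m) (hm : 0 < m) (conflicts : P → P → Prop) (R : Region)
    (K : Anchor) : IsDeep conflicts R K k V B := by
  have htips : ∀ x ∈ preferredFrontier conflicts R K V, x ∈ tips V := fun x hx =>
    (Finset.mem_filter.1 hx).1
  refine ⟨?_, fun x hx l hl => hk.trans (h.le_length x (htips x hx) l hl)⟩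
  obtain ⟨x, hx⟩ := preferredFrontier_nonempty_of_refs_eq (conflicts := conflicts) (R := R)
    (K := K) hV ⟨_, h.mem⟩ h.refs_eq h.genesis_notMem
  refine Finset.mem_filter.2 ⟨h.mem, x, hx, ?_⟩
  rcases h.ancEq with ⟨h0, -⟩ | hall
  · omega
  · exact hall x (htips x hx)

/-! ### The release -/

theorem EpochBounds.withheldRefs_closed {σ : State n P} {C N m : ℕ} (h : EpochBounds σ C N m) :
    RefClosed (withheldRefs σ) := by
  intro b hb
  rcases Finset.mem_insert.1 hb with rfl | hb
  · simp [Block.refs]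
  · exact h.withheld_refs b hb

/-- Releasing enough withheld blocks makes the last forged block the whole preferred frontier. -/
theorem EpochBounds.preferredFrontier_release (hv : v ∉ honest) {t C N m : ℕ} {σ : State n P}
    (hb : EpochBounds σ C N m) (h : Coherent σ t) (ht : t + 1 ∈ T)
    (he : c.eligible (t + 1) v = true) {conflicts : P → P → Prop}
    (hrival : ∀ S, ∀ b ∈ S, ∀ a, Block.payload b = some a → conflicts (rival S) a)
    (R : Region) (K : Anchor) (hCm : C < m) (hm : 2 * ((C + N + n) * C) < m ^ 2) :
    preferredFrontier conflicts R K
      (step honest (withholdingStrategy rival v T) c (t + 1) σ).pub =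
        {forgedBlock honest rival v c (t + 1) σ} := by
  have hcoh : Coherent (step honest (withholdingStrategy rival v T) c (t + 1) σ) (t + 1) :=
    h.succ hv
  have hpub := h.pub_step_of_mem (rival := rival) (c := c) hv ht
  have hcr := created_step (rival := rival) (T := T) (c := c) hv (t + 1)
    (h.pub_subset h.genesis_mem)
  rw [if_pos he] at hcr
  have hrefs : ∀ b ∈ (step honest (withholdingStrategy rival v T) c (t + 1) σ).created,
      b.refs ⊆ σ.created := fun b hb => by
    rcases h.mem_created_step hv hb with hb | ⟨-, -, hb⟩
    exacts [h.created_closed b hb, hb]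
  rw [hpub]
  generalize hV : (step honest (withholdingStrategy rival v T) c (t + 1) σ).created = V at *
  have hVcl : RefClosed V := hV ▸ hcoh.created_closed
  have hVg : Block.genesis ∈ V := hV ▸ hcoh.pub_subset hcoh.genesis_mem
  have hVanc : ∀ b ∈ V, AncEq Block.genesis b := hV ▸ hcoh.genesis_ancEq
  have hxr := refs_forgedBlock (honest := honest) (rival := rival) (v := v) (c := c) (t + 1) σ
  have hxn : forgedBlock honest rival v c (t + 1) σ ∉ σ.created := h.forgedBlock_notMem
  have hpay : (forgedBlock honest rival v c (t + 1) σ).payload =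
    some (rival (σ.created ∪ honestBlocks honest c (t + 1) σ.pub)) := rfl
  have hxg : forgedBlock honest rival v c (t + 1) σ ≠ Block.genesis := by simp [forgedBlock]
  generalize forgedBlock honest rival v c (t + 1) σ = x at *
  have hxV : x ∈ V := by rw [hcr]; simp
  have hxt : x ∈ tips V := Finset.mem_filter.2 ⟨hxV, fun d hd hxd => hxn (hrefs d hd hxd)⟩
  have hanc : ∀ b ∈ V, b ≠ Block.genesis → Anc Block.genesis b := fun b hb hbg =>
    (ancEq_iff.1 (hVanc b hb)).resolve_left (Ne.symm hbg)
  have hbaseV : σ.pub ∪ honestBlocks honest c (t + 1) σ.pub ⊆ V := by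
    rw [hcr]
    exact (Finset.union_subset_union_left h.pub_subset).trans Finset.subset_union_left
  -- The block `x` references genesis and everything withheld, so any other tip was already public
  -- or is an honest block of this slot.
  have hybase : ∀ y ∈ tips V, y ≠ x →
      y ∈ σ.pub ∪ honestBlocks honest c (t + 1) σ.pub ∧ y ≠ Block.genesis := by
    intro y hy hyx
    obtain ⟨hyV, hyt⟩ := Finset.mem_filter.1 hy
    have hyr : y ∉ withheldRefs σ := fun hyr => hyt x hxV (show y ∈ x.refs from hxr ▸ hyr)
    simp only [withheldRefs, Finset.mem_insert, Finset.mem_sdiff, not_or, not_and, not_not] at hyr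
    refine ⟨?_, hyr.1⟩
    rw [hcr] at hyV
    simp only [Finset.mem_union, Finset.mem_singleton] at hyV ⊢
    rcases hyV with (hyV | hyV) | hyV
    · exact .inl (hyr.2 hyV)
    · exact .inr hyV
    · exact absurd hyV hyx
  have hbaser : ∀ y ∈ σ.pub ∪ honestBlocks honest c (t + 1) σ.pub,
      y.refs ⊆ σ.pub ∧ y.refs.card ≤ C := by
    intro y hy
    rcases Finset.mem_union.1 hy with hy | hy
    · exact ⟨h.pub_closed y hy, hb.refs_le y hy⟩
    · rw [(mem_honestBlocks hy).2.1]
      exact ⟨Finset.filter_subset _ _, hb.tips_le⟩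
  have hbanc : ∀ y ∈ σ.pub ∪ honestBlocks honest c (t + 1) σ.pub, ∀ d, Anc d y → d ∈ σ.pub := by
    intro y hy d hd
    obtain ⟨e, he, hde⟩ := anc_iff.1 hd
    exact h.pub_closed.ancEq_mem hde ((hbaser y hy).1 he)
  refine preferredFrontier_eq_singleton hxt ?_ ?_ ?_ ?_
  · intro y hy hyx
    obtain ⟨hyb, hyg⟩ := hybase y hy hyx
    obtain ⟨a, ha⟩ : ∃ a, y.payload = some a := by
      cases y with
      | genesis => exact absurd rfl hyg
      | mk _ _ a _ _ => exact ⟨a, rfl⟩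
    exact ⟨_, a, hpay, ha, hrival _ y (Finset.union_subset_union_left h.pub_subset hyb) a ha⟩
  · intro y hy hyx
    obtain ⟨hyb, hyg⟩ := hybase y hy hyx
    exact exists_isAnchor K hVg (hanc x hxV hxg) (hanc y (hbaseV hyb) hyg)
  -- Strict ancestors of `y` are public, while those of `x` are withheld or genesis.
  · intro y hy hyx d hdx hdy
    have hd := hbanc y (hybase y hy hyx).1 d hdy
    obtain ⟨e, he, hde⟩ := anc_iff.1 hdx
    rw [hxr] at he
    rcases Finset.mem_insert.1 (hb.withheldRefs_closed.ancEq_mem hde he) with hg | hq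
    · exact hg
    · exact absurd hd (Finset.mem_sdiff.1 hq).2
  · intro y hy hyx
    obtain ⟨hyb, -⟩ := hybase y hy hyx
    cases R with
    | descendants =>
      rw [weight_descendants_eq hVcl hy, weight_descendants_eq hVcl hxt, if_pos (hVanc x hxV),
        if_pos (hVanc y (hbaseV hyb)), hxr]
      refine (hbaser y hyb).2.trans_lt (hCm.trans_le (hb.le_card_withheld.trans ?_))
      exact Finset.card_le_card (Finset.subset_insert _ _)
    | between =>
      -- Linear bound: the subDAG of `y` lies in the public part, with at most `C + N + n` blocks of
      -- at most `C` references each.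
      have hy_le : weight .between V y .genesis ≤ (C + N + n) * C := by
        have hsub : V.filter (fun d => InRegion .between y d ∧ AncEq Block.genesis d) ⊆
            σ.pub ∪ honestBlocks honest c (t + 1) σ.pub := by
          intro d hd
          rcases ancEq_iff.1 (Finset.mem_filter.1 hd).2.1 with rfl | hd
          · exact hyb
          · exact Finset.mem_union_left _ (hbanc y hyb d hd)
        have hcard : (σ.pub ∪ honestBlocks honest c (t + 1) σ.pub).card ≤ C + N + n :=
          (Finset.card_union_le _ _).trans
            (Nat.add_le_add hb.card_pub (card_honestBlocks_le honest c (t + 1) σ.pub))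
        calc weight .between V y .genesis
            ≤ ∑ d ∈ σ.pub ∪ honestBlocks honest c (t + 1) σ.pub, d.refs.card :=
              Finset.sum_le_sum_of_subset hsub
          _ ≤ (σ.pub ∪ honestBlocks honest c (t + 1) σ.pub).card * C := by
              rw [← smul_eq_mul]
              exact Finset.sum_le_card_nsmul _ _ _ fun d hd => (hbaser d hd).2
          _ ≤ (C + N + n) * C := Nat.mul_le_mul_right C hcard
      -- Quadratic bound: every withheld block is an ancestor of `x`.
      have hx_le : ∑ q ∈ σ.created \ σ.pub, q.refs.card ≤ weight .between V x .genesis := by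
        refine Finset.sum_le_sum_of_subset fun q hq => ?_
        have hqV : q ∈ V := by
          rw [hcr]
          exact Finset.mem_union_left _ (Finset.mem_union_left _ (Finset.mem_sdiff.1 hq).1)
        refine Finset.mem_filter.2 ⟨hqV, Relation.ReflTransGen.single ?_, hVanc q hqV⟩
        rw [Edge, hxr]
        exact Finset.mem_insert_of_mem hq
      have hsq := Nat.pow_le_pow_left hb.le_card_withheld 2
      have := hb.sq_card_le
      omega

theorem EpochBounds.notMem_ledger_release {t C N m : ℕ} {σ : State n P}
    (hb : EpochBounds σ C N m) (h : Coherent σ t) {conflicts : P → P → Prop} {R : Region}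
    {K : Anchor}
    (hF : preferredFrontier conflicts R K
      (step honest (withholdingStrategy rival v T) c (t + 1) σ).pub =
        {forgedBlock honest rival v c (t + 1) σ})
    {B : Block n P} (hB : B ∈ σ.pub) (hBg : B ≠ Block.genesis) :
    B ∉ ledger conflicts R K
      (step honest (withholdingStrategy rival v T) c (t + 1) σ).pub := by
  intro hL
  obtain ⟨-, x, hx, hBx⟩ := Finset.mem_filter.1 hL
  rw [hF, Finset.mem_singleton] at hx
  subst hx
  rcases ancEq_iff.1 hBx with rfl | hBx
  · exact h.forgedBlock_notMem (h.pub_subset hB)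
  · obtain ⟨e, he, hBe⟩ := anc_iff.1 hBx
    rw [refs_forgedBlock] at he
    rcases Finset.mem_insert.1 (hb.withheldRefs_closed.ancEq_mem hBe he) with hg | hq
    · exact hBg hg
    · exact (Finset.mem_sdiff.1 hq).2 hB

theorem forgedBlock_mem_withheld (hv : v ∉ honest) {s t : ℕ} (hst : s + 1 ≤ t)
    (hT : ∀ r, s + 1 ≤ r → r ≤ t → r ∉ T) (he : c.eligible (s + 1) v = true) :
    forgedBlock honest rival v c (s + 1) (exec honest (withholdingStrategy rival v T) c s) ∈
      (exec honest (withholdingStrategy rival v T) c t).created \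
        (exec honest (withholdingStrategy rival v T) c t).pub := by
  induction t, hst using Nat.le_induction with
  | base =>
    rw [exec, (coherent_exec hv s).withheld_step hv (hT (s + 1) le_rfl le_rfl), if_pos he]
    simp
  | succ t hst ih =>
    have := ih fun r h₁ h₂ => hT r h₁ (h₂.trans (Nat.le_succ t))
    rw [exec, (coherent_exec hv t).withheld_step hv (hT (t + 1) (hst.trans (Nat.le_succ t)) le_rfl)]
    exact Finset.mem_union_left _ this

theorem pub_exec_of_mem (hv : v ∉ honest) {t : ℕ} (ht : t ∈ T) :
    (exec honest (withholdingStrategy rival v T) c t).pub =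
      (exec honest (withholdingStrategy rival v T) c t).created := by
  cases t with
  | zero => rfl
  | succ t => exact (coherent_exec hv t).pub_step_of_mem hv ht

/-- The attack succeeds between consecutive release slots `a` and `t + 1` if the corrupt validator
and some honest one are simultaneously eligible often enough in between. -/
theorem withholdingReversion (hv : v ∉ honest) {w : Fin n} (hw : w ∈ honest) {a t C k : ℕ}
    {G : Finset ℕ} (ha : a ∈ T) (ht : t + 1 ∈ T) (hT : ∀ s, a < s → s ≤ t → s ∉ T)
    (hC : 1 + (n + 1) * a + n ≤ C)
    (hG : ∀ s ∈ G, a < s ∧ s ≤ t ∧ c.eligible s v = true ∧ c.eligible s w = true)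
    (he : c.eligible (t + 1) v = true) {conflicts : P → P → Prop}
    (hrival : ∀ S, ∀ b ∈ S, ∀ a, Block.payload b = some a → conflicts (rival S) a)
    (R : Region) (K : Anchor) (hk : k + 2 ≤ G.card) (hCm : C < G.card)
    (hm : 2 * ((C + n * (t - a) + n) * C) < G.card ^ 2) :
    WithholdingReversion conflicts R K honest (withholdingStrategy rival v T) c k t (t + 1) := by
  have hGne : G.Nonempty := Finset.card_pos.1 (by omega)
  obtain ⟨hsa, hst, hsv, hsw⟩ := hG _ (G.min'_mem hGne)
  -- The first joint slot `s + 1` supplies both the honest block `B` and the long-withheld block.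
  -- The other members of `G` bury `B` and show that at least `k` slots have passed.
  obtain ⟨s, hs⟩ : ∃ s, G.min' hGne = s + 1 := ⟨G.min' hGne - 1, by omega⟩
  have hcoh := coherent_exec (rival := rival) (T := T) (c := c) hv t
  have hGt : G.filter (· ≤ t) = G := Finset.filter_true_of_mem fun r hr => (hG r hr).2.1
  have hbd := epochBounds_exec (rival := rival) (c := c) (G := G) hv (hsa.le.trans hst)
    (pub_exec_of_mem hv ha) hT hC fun r hr => ⟨(hG r hr).1, (hG r hr).2.2.1⟩
  rw [hGt] at hbd
  rw [hs] at hsa hst hsv hsw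
  have hT' : ∀ r, s + 1 ≤ r → r ≤ t → r ∉ T := fun r h₁ h₂ => hT r (by omega) h₂
  have hF := hbd.preferredFrontier_release (rival := rival) hv hcoh ht he hrival R K hCm hm
  obtain ⟨B, hB, hBv⟩ : ∃ B ∈ honestBlocks honest c (s + 1)
      (exec honest (withholdingStrategy rival v T) c s).pub, B.validator = some w :=
    ⟨_, Finset.mem_image_of_mem _ (by simp [eligibleSet, hsw, hw]), rfl⟩
  have hG' : ∀ r ∈ G.erase (s + 1), s + 1 < r ∧ r ≤ t ∧ c.eligible r w = true := fun r hr => by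
    obtain ⟨hne, hr⟩ := Finset.mem_erase.1 hr
    have := G.min'_le r hr
    exact ⟨by omega, (hG r hr).2.1, (hG r hr).2.2.2⟩
  have hcard : (G.erase (s + 1)).card = G.card - 1 :=
    Finset.card_erase_of_mem (hs ▸ G.min'_mem hGne)
  have hsink := sinking_exec (rival := rival) (T := T) hv hw (G := G.erase (s + 1)) hst hB hT'
    fun r hr => ⟨(hG' r hr).1, (hG' r hr).2.2⟩
  rw [Finset.filter_true_of_mem fun r hr => (hG' r hr).2.1] at hsink
  refine ⟨⟨B, ⟨w, hw, hBv⟩, hsink.isDeep hcoh.pub_closed (by omega) (by omega) _ _ _,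
    hbd.notMem_ledger_release hcoh hF hsink.mem (mem_honestBlocks hB).2.2.2⟩, ?_, ?_⟩
  · rw [exec, hF]
    exact Finset.singleton_nonempty _
  · have hq := Finset.mem_sdiff.1 (forgedBlock_mem_withheld (rival := rival) hv hst hT' hsv)
    refine ⟨_, hq.1, ?_, hq.2, ?_⟩
    · have hle : (G.erase (s + 1)).card ≤ (Finset.Ioc (s + 1) t).card :=
        Finset.card_le_card fun r hr => Finset.mem_Ioc.2 ⟨(hG' r hr).1, (hG' r hr).2.1⟩
      rw [Nat.card_Ioc] at hle
      change s + 1 + k ≤ t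
      omega
    · rw [pub_exec_of_mem hv ht]
      exact hcoh.subset_created_step hv hq.1

end Epoch

/-! ### The probability of a good epoch -/

/-- Reverse Markov inequality for the number of events that occur. -/
theorem le_measureReal_card_filter {Ω ι : Type*} [MeasurableSpace Ω] (μ : Measure Ω)
    [IsProbabilityMeasure μ] (S : Finset ι) (A : ι → Set Ω) (hA : ∀ i ∈ S, MeasurableSet (A i))
    {q : ℝ} (hq : ∀ i ∈ S, q ≤ μ.real (A i)) (hS : 0 < S.card) {m : ℕ}
    (hm : m ≤ q / 2 * S.card) :
    q / 2 ≤ μ.real {ω | m ≤ (S.filter fun i => ω ∈ A i).card} ∧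
      MeasurableSet {ω | m ≤ (S.filter fun i => ω ∈ A i).card} := by
  have hcount : ∀ ω, ((S.filter fun i => ω ∈ A i).card : ℝ) =
      ∑ i ∈ S, (A i).indicator (fun _ => (1 : ℝ)) ω := by
    intro ω
    simp [Set.indicator_apply]
  have hmeas : MeasurableSet {ω | m ≤ (S.filter fun i => ω ∈ A i).card} := by
    have : {ω | m ≤ (S.filter fun i => ω ∈ A i).card} =
        {ω | (m : ℝ) ≤ ∑ i ∈ S, (A i).indicator (fun _ => (1 : ℝ)) ω} := by
      ext ω
      simp only [Set.mem_ofPred_eq, ← hcount, Nat.cast_le]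
    rw [this]
    exact measurableSet_le measurable_const
      (Finset.measurable_sum _ fun i hi => measurable_const.indicator (hA i hi))
  refine ⟨?_, hmeas⟩
  set E := {ω | m ≤ (S.filter fun i => ω ∈ A i).card} with hE
  have hint : ∀ i ∈ S, Integrable ((A i).indicator fun _ => (1 : ℝ)) μ := fun i hi =>
    (integrable_const 1).indicator (hA i hi)
  have hintE : Integrable (E.indicator fun _ => (S.card : ℝ)) μ :=
    (integrable_const _).indicator hmeas
  -- Pointwise the count is at most `S.card` on `E` and less than `m` off `E`. Integrating needs no
  -- independence of the events.
  have hle : ∫ ω, ∑ i ∈ S, (A i).indicator (fun _ => (1 : ℝ)) ω ∂μ ≤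
      ∫ ω, (E.indicator (fun _ => (S.card : ℝ)) ω + m) ∂μ := by
    refine integral_mono (integrable_finsetSum _ hint) (hintE.add (integrable_const _)) ?_
    intro ω
    change ∑ i ∈ S, (A i).indicator (fun _ => (1 : ℝ)) ω ≤ _
    rw [← hcount]
    by_cases hω : ω ∈ E
    · have h₁ : ((S.filter fun i => ω ∈ A i).card : ℝ) ≤ S.card :=
        Nat.cast_le.2 (Finset.card_filter_le _ _)
      have h₂ : (0 : ℝ) ≤ m := Nat.cast_nonneg m
      simp only [Set.indicator_of_mem hω]
      linarith
    · have h₁ : (S.filter fun i => ω ∈ A i).card < m := not_le.1 hω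
      simp only [Set.indicator_of_notMem hω, zero_add]
      exact_mod_cast h₁.le
  rw [integral_finsetSum _ hint, integral_add hintE (integrable_const _),
    integral_indicator_const _ hmeas, integral_const] at hle
  have hsum : S.card * q ≤ ∑ i ∈ S, ∫ ω, (A i).indicator (fun _ => (1 : ℝ)) ω ∂μ := by
    rw [← nsmul_eq_mul]
    refine Finset.card_nsmul_le_sum _ _ _ fun i hi => ?_
    rw [integral_indicator_const _ (hA i hi)]
    simpa using hq i hi
  have hS' : (0 : ℝ) < S.card := Nat.cast_pos.2 hS
  simp only [probReal_univ, smul_eq_mul, one_mul] at hle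
  refine le_of_mul_le_mul_right ?_ hS'
  linarith

theorem measure_three_eligible {Ω ι : Type*} [MeasurableSpace Ω] {μ : Measure Ω}
    {f : ι → Ω → Bool} (hf : ∀ i, Measurable (f i)) (hind : iIndepFun f μ) {q : ENNReal}
    (hq : ∀ i, μ {ω | f i ω = true} = q) {i j l : ι} (hij : i ≠ j) (hil : i ≠ l) (hjl : j ≠ l) :
    μ {ω | f i ω = true ∧ f j ω = true ∧ f l ω = true} = q ^ 3 ∧
      MeasurableSet {ω | f i ω = true ∧ f j ω = true ∧ f l ω = true} := by
  have hset : {ω | f i ω = true ∧ f j ω = true ∧ f l ω = true} =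
      ⋂ r ∈ ({i, j, l} : Finset ι), f r ⁻¹' {true} := by
    ext ω
    simp
  have hmeas : ∀ r, MeasurableSet (f r ⁻¹' {true}) := fun r => hf r (measurableSet_singleton _)
  rw [hset]
  refine ⟨?_, Finset.measurableSet_biInter _ fun r _ => hmeas r⟩
  rw [hind.measure_inter_preimage_eq_mul {i, j, l} fun r _ => measurableSet_singleton _]
  have hq' : ∀ r, μ (f r ⁻¹' {true}) = q := hq
  simp only [hq', Finset.prod_const]
  congr 1
  rw [Finset.card_insert_of_notMem (by simp [hij, hil]), Finset.card_pair hjl]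

/-! ### Release slots -/

/-- Bound on the number of references of a public block in the epoch that starts in slot `a`. -/
def refBound (n a : ℕ) : ℕ := 1 + (n + 1) * a + n

/-- How often the corrupt and the honest validator have to be eligible together. -/
def requiredCount (n r a k : ℕ) : ℕ :=
  2 * ((refBound n a + n * (r + 1)) * refBound n a) + k + 2

/-- The release slots: each epoch has `r` slots per required joint eligibility. -/
def releaseSlot (n r : ℕ) : ℕ → ℕ
  | 0 => 0
  | k + 1 => releaseSlot n r k + r * requiredCount n r (releaseSlot n r k) k + 1

theorem releaseSlot_strictMono (n r : ℕ) : StrictMono (releaseSlot n r) :=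
  strictMono_nat_of_lt_succ fun k => by
    rw [releaseSlot]
    omega

theorem refBound_lt_requiredCount (n r a k : ℕ) : refBound n a < requiredCount n r a k := by
  unfold requiredCount
  have : 1 ≤ refBound n a := by unfold refBound; omega
  nlinarith [Nat.zero_le (n * (r + 1) * refBound n a)]

/-- The epoch length is proportional to the count `M`, so the left side is at most a constant times
`M`, and `requiredCount` is chosen to exceed that constant. -/
theorem weight_lt_requiredCount_sq (n r a k : ℕ) :
    2 * ((refBound n a + n * (r * requiredCount n r a k) + n) * refBound n a) <
      requiredCount n r a k ^ 2 := by
  have hM : 2 * ((refBound n a + n * (r + 1)) * refBound n a) + 2 ≤ requiredCount n r a k := by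
    unfold requiredCount; omega
  generalize requiredCount n r a k = M at *
  generalize refBound n a = C at *
  have h1 : 1 ≤ M := by omega
  have h2 : C + n * (r * M) + n ≤ (C + n * (r + 1)) * M := by
    nlinarith [Nat.mul_le_mul_left C h1, Nat.mul_le_mul_left n h1]
  have h3 := Nat.mul_le_mul_right C h2
  nlinarith [Nat.mul_le_mul_right M hM]

end SubDAG

end

/-! ### Assembly: one strategy for all depths. -/

open SubDAG in
theorem mainTheorem11 {n : ℕ} {P : Type*}
    (honest : Finset (Fin n)) (honest_majority : n < 2 * honest.card)
    (some_corrupt : honest ≠ Finset.univ)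
    (conflicts : P → P → Prop) (conflicts_symm : ∀ a b, conflicts a b → conflicts b a)
    (conflicts_exist : ∀ S : Finset P, ∃ a, ∀ x ∈ S, conflicts a x)
    (R : SubDAG.Region) (K : SubDAG.Anchor)
    {Ω : Type*} [MeasurableSpace Ω] (μ : Measure Ω) [IsProbabilityMeasure μ]
    (coins : Ω → SubDAG.Coins n P) (p : ℝ) (p_pos : 0 < p) (p_le_one : p ≤ 1)
    (eligible_meas : ∀ t v, Measurable fun ω => (coins ω).eligible t v)
    (eligible_indep : iIndepFun (fun (i : ℕ × Fin n) ω => (coins ω).eligible i.1 i.2) μ)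
    (eligible_prob : ∀ t v, μ {ω | (coins ω).eligible t v = true} = ENNReal.ofReal p) :
    ∃ A : SubDAG.Strategy n P, ∃ ε : ℝ, 0 < ε ∧
      ∀ k : ℕ, ∃ t₁ t₂ : ℕ, t₁ < t₂ ∧
        ∃ E : Set Ω, MeasurableSet E ∧ ENNReal.ofReal ε ≤ μ E ∧
          ∀ ω ∈ E, SubDAG.WithholdingReversion conflicts R K honest A (coins ω) k t₁ t₂ := by
  obtain ⟨v, hv⟩ : ∃ v, v ∉ honest := by
    by_contra! h
    exact some_corrupt (Finset.eq_univ_iff_forall.2 h)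
  obtain ⟨w, hw⟩ : honest.Nonempty := Finset.card_pos.1 (by omega)
  have hvw : v ≠ w := fun h => hv (h ▸ hw)
  obtain ⟨rival, hrival⟩ : ∃ rival : Finset (Block n P) → P,
      ∀ S, ∀ b ∈ S, ∀ a, Block.payload b = some a → conflicts (rival S) a := by
    choose f hf using fun S : Finset (Block n P) =>
      conflicts_exist (S.biUnion fun b => b.payload.toFinset)
    exact ⟨f, fun S b hb a ha => hf S a (Finset.mem_biUnion.2 ⟨b, hb, by simp [ha]⟩)⟩
  -- With `r * M` slots the expected number of good slots is `p³ * r * M ≥ 2 * M`, twice what is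
  -- required.
  obtain ⟨r, hr⟩ := exists_nat_ge (2 / p ^ 3)
  have hp3 : 0 < p ^ 3 := pow_pos p_pos 3
  have hr0 : 0 < r := by
    have : (0 : ℝ) < r := (div_pos two_pos hp3).trans_le hr
    exact_mod_cast this
  refine ⟨withholdingStrategy rival v (Set.range (releaseSlot n r)), p ^ 3 / 2, by positivity,
    fun k => ?_⟩
  set a := releaseSlot n r k with ha
  set M := requiredCount n r a k with hM
  set t := a + r * M with ht
  have hnext : releaseSlot n r (k + 1) = t + 1 := rfl
  have hM0 : k + 2 ≤ M := by
    rw [hM]; unfold requiredCount; omega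
  -- Eligibility at the release slot is built into each event, so a single occurrence already
  -- ensures that the last block can be forged.
  let A : ℕ → Set Ω := fun s => {ω | (coins ω).eligible (t + 1) v = true ∧
    (coins ω).eligible s v = true ∧ (coins ω).eligible s w = true}
  have hcard : (Finset.Ioc a t).card = r * M := by rw [Nat.card_Ioc]; omega
  have hA : ∀ s ∈ Finset.Ioc a t, μ (A s) = ENNReal.ofReal p ^ 3 ∧ MeasurableSet (A s) := by
    intro s hs
    have hst := (Finset.mem_Ioc.1 hs).2
    exact measure_three_eligible (f := fun (i : ℕ × Fin n) ω => (coins ω).eligible i.1 i.2)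
      (i := (t + 1, v)) (j := (s, v)) (l := (s, w)) (fun i => eligible_meas i.1 i.2)
      eligible_indep (fun i => eligible_prob i.1 i.2) (by simp; omega) (by simp; omega)
      (by simp [hvw])
  obtain ⟨hE, hEm⟩ := le_measureReal_card_filter μ (Finset.Ioc a t) A (fun s hs => (hA s hs).2)
    (q := p ^ 3) (m := M)
    (fun s hs => by
      rw [measureReal_def, (hA s hs).1, ← ENNReal.ofReal_pow p_pos.le,
        ENNReal.toReal_ofReal hp3.le])
    (by rw [hcard]; exact Nat.mul_pos hr0 (by omega))
    (by
      rw [hcard]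
      push_cast
      rw [div_le_iff₀ hp3] at hr
      nlinarith [Nat.cast_nonneg (α := ℝ) M])
  refine ⟨t, t + 1, Nat.lt_succ_self t, _, hEm, ?_, ?_⟩
  · rw [ENNReal.ofReal_le_iff_le_toReal (measure_ne_top _ _)]
    exact hE
  · intro ω hω
    set G := (Finset.Ioc a t).filter fun s => ω ∈ A s
    rw [Set.mem_ofPred_eq] at hω
    replace hω : M ≤ G.card := by convert hω
    have hG : ∀ s ∈ G, s ∈ Finset.Ioc a t ∧ (coins ω).eligible (t + 1) v = true ∧
        (coins ω).eligible s v = true ∧ (coins ω).eligible s w = true := fun s hs => by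
      simpa only [G, A, Finset.mem_filter, Set.mem_ofPred_eq] using hs
    obtain ⟨s, hs⟩ : G.Nonempty := Finset.card_pos.1 (by omega)
    replace hs := hG s hs
    refine withholdingReversion (a := a) (t := t) (T := Set.range (releaseSlot n r)) (C := refBound n a) (G := G) hv hw ⟨k, rfl⟩ ⟨k + 1, hnext⟩ ?_ le_rfl
      (fun s hs => ?_) hs.2.1 hrival R K (by omega)
      ((refBound_lt_requiredCount n r a k).trans_le hω) ?_
    · rintro _ h₁ h₂ ⟨j, rfl⟩
      have hj₁ := (releaseSlot_strictMono n r).lt_iff_lt.1 h₁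
      have hj₂ := (releaseSlot_strictMono n r).lt_iff_lt.1 ((Nat.lt_succ_of_le h₂).trans_eq hnext.symm)
      omega
    · obtain ⟨h₁, -, h₂, h₃⟩ := hG s hs
      exact ⟨(Finset.mem_Ioc.1 h₁).1, (Finset.mem_Ioc.1 h₁).2, h₂, h₃⟩
    · have hta : t - a = r * M := by omega
      rw [hta]
      exact (weight_lt_requiredCount_sq n r a k).trans_le (Nat.pow_le_pow_left hω 2)
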